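/- Let $K\ge 1$ be an integer, let $\rho\in(-1,1)$ and $\delta>0$ be real, with $\delta$ an integer if $\rho<0$, and let $P_k>0$ and $\sigma_k>0$ for $k=1,\dots,K$. Let $\alpha_0,\alpha_1,\dots,\alpha_K$ be independent circularly-symmetric complex normal random variables with zero mean and unit variance ($\mathcal{CN}(0,1)$), and let $$\gamma_k=P_k|h_k|^2,\qquad h_k=\sigma_k\Big(\sqrt{1-\rho^{2(k+\delta-1)}}\,\alpha_k+\rho^{k+\delta-1}\alpha_0\Big),\qquad k=1,\dots,K,$$ be the SNRs of the exponentially correlated Rayleigh channel. Put $G=\prod_{k=1}^K(1+\gamma_k)$ and, for $k=1,\dots,K$, $$\Omega_k=P_k\sigma_k^2\big(1-\rho^{2(k+\delta-1)}\big),\qquad a_k=\frac{\rho^{2(k+\delta-1)}}{1-\rho^{2(k+\delta-1)}},\qquad w_k=a_k\Big(1+\sum_{\iota=1}^K a_\iota\Big)^{-1}.$$ For $\mathbf l=(l_1,\dots,l_K)\in\mathbb N_0^K$ let $\mathcal A_{\mathbf l}=\prod_{k=1}^K(1+R_{\mathbf l,k})$, where $R_{\mathbf l,1},\dots,R_{\mathbf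 l,K}$ are independent and $R_{\mathbf l,k}$ has the Gamma distribution with shape $1+l_k$ and scale $\Omega_k$, and let $$W_{\mathbf l}=\Big(1+\sum_{k=1}^K a_k\Big)^{-1}\Big(\sum_{k=1}^K l_k\Big)!\,\prod_{k=1}^K\frac{w_k^{l_k}}{l_k!}.$$ Then $G$ and every $\mathcal A_{\mathbf l}$ have probability density functions $f_G$ and $f_{\mathcal A_{\mathbf l}}$ with respect to Lebesgue measure, and for almost every $x\in\mathbb R$ $$f_G(x)=\sum_{\mathbf l\in\mathbb N_0^K}W_{\mathbf l}\,f_{\mathcal A_{\mathbf l}}(x).$$ Moreover $w_k\ge 0$ for all $k$, $\sum_{k=1}^K w_k<1$, and $(W_{\mathbf l})_{\mathbf l\in\mathbb N_0^K}$ is the probability mass function of the negative multinomial distribution $\mathrm{NM}(1,\mathbf w)$ with $\mathbf w=(w_1,\dots,w_K)$, that is, $$W_{\mathbf l}=\frac{\Gamma\big(1+\sum_k l_k\big)}{\Gamma(1)}\Big(1-\sum_{k=1}^K w_k\Big)\prod_{k=1}^K\frac{w_k^{l_k}}{l_k!}\ge 0,\qquad \sum_{\mathbf l\in\mathbb N_0^K}W_{\mathbf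 l}=1.$$ -/

import Mathlib

/-!
Conditionally on `α_0`, the SNRs are independent and each `γ_k` is a scaled noncentral `χ²` variable
with two degrees of freedom, that is, a Poisson mixture of Gamma laws: comparing characteristic
functions, this is the expansion of `exp (|m|² / (1 - i t Ω))`. The Poisson intensities are
`a_k |α_0|²`, and `|α_0|²` is exponential; multiplying the exponential density by the Poisson
weights gives a multiple of a Gamma density, so that integrating out `α_0` turns the Poisson weights
into negative multinomial ones. Pushing this mixture of product laws forward under
`r ↦ ∏ (1 + r_k)`, which preserves absolute continuity, gives the mixture of densities.
-/

open MeasureTheory ProbabilityTheory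
open scoped Nat

namespace CorrRayleigh

/-- The circularly-symmetric complex normal law `CN(0,1)` (zero mean, `E|α|² = 1`): real and
imaginary parts are independent real Gaussians with mean `0` and variance `1/2`. -/
noncomputable def complexNormal : Measure ℂ :=
  ((gaussianReal 0 (1 / 2)).prod (gaussianReal 0 (1 / 2))).map
    (fun z : ℝ × ℝ => (⟨z.1, z.2⟩ : ℂ))

/-- The exponent `k + δ - 1` of the `k`-th transmission, `k = 1, …, K`; the index `k : Fin K`
starts at `0`, so that it stands for the transmission number `k + 1`. -/
def lag {K : ℕ} (δ : ℝ) (k : Fin K) : ℝ := ((k : ℕ) + 1 : ℝ) + δ - 1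

/-- The exponentially correlated Rayleigh channel coefficient
`h_k = σ_k (√(1 - ρ^{2(k+δ-1)}) α_k + ρ^{k+δ-1} α_0)`. -/
noncomputable def channel {K : ℕ} {S : Type*} (ρ δ : ℝ) (σ : Fin K → ℝ)
    (α : Fin (K + 1) → S → ℂ) (k : Fin K) (s : S) : ℂ :=
  (σ k : ℂ) * ((Real.sqrt (1 - ρ ^ (2 * lag δ k)) : ℂ) * α k.succ s
    + ((ρ ^ lag δ k : ℝ) : ℂ) * α 0 s)

/-- The received SNR `γ_k = P_k |h_k|²`. -/
noncomputable def snr {K : ℕ} {S : Type*} (ρ δ : ℝ) (σ p : Fin K → ℝ)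
    (α : Fin (K + 1) → S → ℂ) (k : Fin K) (s : S) : ℝ :=
  p k * ‖channel ρ δ σ α k s‖ ^ 2

/-- `G = ∏_k (1 + γ_k)`. -/
noncomputable def snrProd {K : ℕ} {S : Type*} (ρ δ : ℝ) (σ p : Fin K → ℝ)
    (α : Fin (K + 1) → S → ℂ) (s : S) : ℝ :=
  ∏ k, (1 + snr ρ δ σ p α k s)

/-- The scale `Ω_k = P_k σ_k² (1 - ρ^{2(k+δ-1)})`. -/
noncomputable def scale {K : ℕ} (ρ δ : ℝ) (σ p : Fin K → ℝ) (k : Fin K) : ℝ :=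
  p k * σ k ^ 2 * (1 - ρ ^ (2 * lag δ k))

/-- The joint law of independent `R_{l,k} ~ Gamma(shape 1 + l_k, scale Ω_k)`, `k = 1, …, K`.
Mathlib's `gammaMeasure` takes the shape and the rate, which is the inverse of the scale. -/
noncomputable def gammaLaw {K : ℕ} (Ω : Fin K → ℝ) (l : Fin K → ℕ) : Measure (Fin K → ℝ) :=
  Measure.pi fun k => gammaMeasure (1 + (l k : ℝ)) (Ω k)⁻¹

/-- `A = ∏_k (1 + R_k)` as a function of `(R_1, …, R_K)`. -/
def shiftedProd {K : ℕ} (r : Fin K → ℝ) : ℝ := ∏ k, (1 + r k)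

/-- `f_{A_l}`: the PDF of the product of the independent shifted Gamma variables
`1 + R_{l,k}`. -/
noncomputable def pdfA {K : ℕ} (Ω : Fin K → ℝ) (l : Fin K → ℕ) (x : ℝ) : ℝ :=
  (pdf (shiftedProd (K := K)) (gammaLaw Ω l) volume x).toReal

/-- `ρ^{2(k+δ-1)} / (1 - ρ^{2(k+δ-1)})`. -/
noncomputable def ratio {K : ℕ} (ρ δ : ℝ) (k : Fin K) : ℝ :=
  ρ ^ (2 * lag δ k) / (1 - ρ ^ (2 * lag δ k))

/-- The parameters `w_k`. -/
noncomputable def w {K : ℕ} (ρ δ : ℝ) (k : Fin K) : ℝ :=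
  ratio ρ δ k * (1 + ∑ i : Fin K, ratio ρ δ i)⁻¹

/-- The weights `W_l`. -/
noncomputable def W {K : ℕ} (ρ δ : ℝ) (l : Fin K → ℕ) : ℝ :=
  (1 + ∑ k : Fin K, ratio ρ δ k)⁻¹ * ((∑ k, l k)! : ℝ) * ∏ k, w ρ δ k ^ l k / ((l k)! : ℝ)

/-- The probability mass function of the negative multinomial law `NM(r, q)`, with
`q_0 = 1 - ∑ q_k`:
`l ↦ Γ(r + ∑ l_k) / Γ(r) * q_0^r * ∏ q_k^{l_k} / l_k!`. -/
noncomputable def negMultinomial {K : ℕ} (r : ℝ) (q : Fin K → ℝ) (l : Fin K → ℕ) : ℝ :=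
  Real.Gamma (r + ∑ k, (l k : ℝ)) / Real.Gamma r * (1 - ∑ k, q k) ^ r *
    ∏ k, q k ^ l k / ((l k)! : ℝ)

end CorrRayleigh

namespace CorrRayleigh

section Mixtures

variable {α β γ : Type*} [MeasurableSpace α] [MeasurableSpace β] [MeasurableSpace γ]

lemma bind_eq_sum_smul [Countable α] [MeasurableSingletonClass α] (μ : Measure α)
    (κ : α → Measure β) : μ.bind κ = Measure.sum fun a => μ {a} • κ a := by
  have hκ : Measurable κ := measurable_of_countable κ
  conv_lhs => rw [← μ.sum_smul_dirac]
  simp only [Measure.bind_sum _ _ hκ.aemeasurable, Measure.bind_smul, Measure.dirac_bind hκ]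

lemma map_bind {κ : α → Measure β} (hκ : Measurable κ) {f : β → γ} (hf : Measurable f)
    (μ : Measure α) : (μ.bind κ).map f = μ.bind fun a => (κ a).map f := by
  simp only [← Measure.bind_dirac_eq_map _ hf]
  exact Measure.bind_bind hκ.aemeasurable (Measure.measurable_dirac.comp hf).aemeasurable

lemma bind_map {κ : β → Measure γ} (hκ : Measurable κ) {f : α → β} (hf : Measurable f)
    (μ : Measure α) : (μ.map f).bind κ = μ.bind fun a => κ (f a) := by
  rw [Measure.bind, Measure.map_map hκ hf, Measure.bind, Function.comp_def]

lemma map_prod_eq_bind (μ : Measure α) (ν : Measure β) [SFinite ν] {g : α × β → γ}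
    (hg : Measurable g) : (μ.prod ν).map g = μ.bind fun a => ν.map fun b => g (a, b) := by
  rw [Measure.prod_def, map_bind Measurable.map_prodMk_left hg]
  congr 1 with a : 1
  exact Measure.map_map hg measurable_prodMk_left

lemma hasSum_charFun_bind [Countable α] [MeasurableSingletonClass α] (μ : Measure α)
    [IsProbabilityMeasure μ] (κ : α → Measure ℝ) [∀ a, IsProbabilityMeasure (κ a)] (t : ℝ) :
    HasSum (fun a => μ.real {a} * charFun (κ a) t) (charFun (μ.bind κ) t) := by
  have : IsProbabilityMeasure (μ.bind κ) :=
    isProbabilityMeasure_bind (measurable_of_countable κ).aemeasurable (ae_of_all _ inferInstance)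
  have hint : Integrable (fun x : ℝ => Complex.exp (t * x * Complex.I)) (μ.bind κ) :=
    .of_bound (by fun_prop) 1 (ae_of_all _ fun x => by
      rw [← Complex.ofReal_mul, Complex.norm_exp_ofReal_mul_I])
  rw [bind_eq_sum_smul] at hint
  simp only [charFun_apply_real, bind_eq_sum_smul]
  simpa only [integral_smul_measure, Complex.real_smul, Measure.real] using
    hasSum_integral_measure hint

variable {ι : Type*} [Fintype ι]

lemma measurable_pi_measure {X : ι → Type*} [∀ i, MeasurableSpace (X i)]
    {κ : ∀ i, α → Measure (X i)} (hκ : ∀ i, Measurable (κ i))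
    [∀ i a, IsProbabilityMeasure (κ i a)] :
    Measurable fun a => Measure.pi fun i => κ i a := by
  refine Measurable.measure_of_isPiSystem_of_isProbabilityMeasure generateFrom_pi.symm
    isPiSystem_pi ?_
  rintro _ ⟨s, hs, rfl⟩
  simp only [Measure.pi_pi]
  exact Finset.measurable_fun_prod _ fun i _ =>
    (Measure.measurable_coe (hs i (Set.mem_univ i))).comp (hκ i)

lemma lintegral_pi_prod {X : ι → Type*} [∀ i, MeasurableSpace (X i)] (μ : ∀ i, Measure (X i))
    [∀ i, IsProbabilityMeasure (μ i)] {f : ∀ i, X i → ENNReal} (hf : ∀ i, Measurable (f i)) :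
    ∫⁻ x, ∏ i, f i (x i) ∂Measure.pi μ = ∏ i, ∫⁻ x, f i x ∂μ i := by
  have hind := iIndepFun_pi (μ := μ) fun i => (hf i).aemeasurable
  rw [lintegral_prod_eq_prod_lintegral_of_indepFun Finset.univ _ hind
    fun i => (hf i).comp (measurable_pi_apply i)]
  exact Finset.prod_congr rfl fun i _ =>
    (measurePreserving_eval μ i).lintegral_comp (hf i)

lemma pi_bind {X Y : ι → Type*} [∀ i, MeasurableSpace (X i)] [∀ i, MeasurableSpace (Y i)]
    (μ : ∀ i, Measure (X i)) [∀ i, IsProbabilityMeasure (μ i)] {κ : ∀ i, X i → Measure (Y i)}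
    (hκ : ∀ i, Measurable (κ i)) [∀ i x, IsProbabilityMeasure (κ i x)] :
    Measure.pi (fun i => (μ i).bind (κ i)) =
      (Measure.pi μ).bind fun x => Measure.pi fun i => κ i (x i) := by
  have hbind : ∀ i, IsProbabilityMeasure ((μ i).bind (κ i)) := fun i =>
    isProbabilityMeasure_bind (hκ i).aemeasurable (ae_of_all _ inferInstance)
  refine Measure.pi_eq fun s hs => ?_
  have hpi : Measurable fun x : ∀ i, X i => Measure.pi fun i => κ i (x i) :=
    measurable_pi_measure (κ := fun i (x : ∀ i, X i) => κ i (x i)) fun i =>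
      (hκ i).comp (measurable_pi_apply i)
  simp only [Measure.bind_apply (.univ_pi hs) hpi.aemeasurable, Measure.pi_pi,
    Measure.bind_apply (hs _) (hκ _).aemeasurable]
  exact lintegral_pi_prod μ fun i => (Measure.measurable_coe (hs i)).comp (hκ i)

end Mixtures

section Densities

lemma bind_absolutelyContinuous {α β : Type*} [MeasurableSpace α] [MeasurableSpace β]
    {μ : Measure α} {κ : α → Measure β} {ξ : Measure β} (hκ : Measurable κ)
    (hac : ∀ a, κ a ≪ ξ) : μ.bind κ ≪ ξ := by
  refine .mk fun s hs hs0 => ?_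
  simp [Measure.bind_apply hs hκ.aemeasurable, hac _ hs0]

lemma ae_hasSum_rnDeriv_bind {α β : Type*} [MeasurableSpace α] [MeasurableSpace β] [Countable α]
    [MeasurableSingletonClass α] (μ : Measure α) [IsProbabilityMeasure μ] {κ : α → Measure β}
    [∀ a, IsProbabilityMeasure (κ a)] {ξ : Measure β} [SigmaFinite ξ] (hac : ∀ a, κ a ≪ ξ) :
    ∀ᵐ x ∂ξ, HasSum (fun a => μ.real {a} * ((κ a).rnDeriv ξ x).toReal)
      ((μ.bind κ).rnDeriv ξ x).toReal := by
  have hprob : IsProbabilityMeasure (μ.bind κ) :=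
    isProbabilityMeasure_bind (measurable_of_countable κ).aemeasurable (ae_of_all _ inferInstance)
  have hmeas : ∀ a, Measurable ((μ {a} • κ a).rnDeriv ξ) := fun a => Measure.measurable_rnDeriv _ _
  have hdens : μ.bind κ = ξ.withDensity (∑' a, (μ {a} • κ a).rnDeriv ξ) := by
    rw [withDensity_tsum hmeas, bind_eq_sum_smul]
    congr 1 with a : 1
    have : IsFiniteMeasure (μ {a} • κ a) := (κ a).smul_finite (measure_ne_top μ {a})
    exact (Measure.withDensity_rnDeriv_eq _ _ ((hac a).smul_left (μ {a}))).symm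
  have hderiv : (μ.bind κ).rnDeriv ξ =ᵐ[ξ] fun x => ∑' a, (μ {a} • κ a).rnDeriv ξ x := by
    have htsum : ∑' a, (μ {a} • κ a).rnDeriv ξ = fun x => ∑' a, (μ {a} • κ a).rnDeriv ξ x :=
      funext fun x => tsum_apply (Pi.summable.mpr fun _ => ENNReal.summable)
    rw [hdens, htsum]
    exact Measure.rnDeriv_withDensity _ (Measurable.tsum hmeas)
  filter_upwards [hderiv, Measure.rnDeriv_lt_top (μ.bind κ) ξ, ae_all_iff.mpr fun a =>
    Measure.rnDeriv_smul_left_of_ne_top (κ a) ξ (measure_ne_top μ {a})] with x hx hlt hsmul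
  rw [hx] at hlt ⊢
  have hsum := ENNReal.hasSum_toReal hlt.ne
  rw [← ENNReal.tsum_toReal_eq (ENNReal.ne_top_of_tsum_ne_top hlt.ne)] at hsum
  simpa only [hsmul, Pi.smul_apply, smul_eq_mul, ENNReal.toReal_mul, Measure.real]
    using hsum

lemma map_mul_prod_absolutelyContinuous {μ ν : Measure ℝ} [SFinite μ] [SFinite ν]
    (hμ : μ {0} = 0) (hν : ν ≪ volume) :
    (μ.prod ν).map (fun z => z.1 * z.2) ≪ volume := by
  have hne : ∀ᵐ a ∂μ, a ≠ 0 := compl_mem_ae_iff.mpr hμ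
  refine .mk fun N hN hN0 => ?_
  rw [Measure.map_apply (by fun_prop) hN, Measure.measure_prod_null (hN.preimage (by fun_prop))]
  filter_upwards [hne] with a ha
  refine hν ?_
  rw [← Set.preimage_comp]
  exact (Real.volume_preimage_mul_left ha N).trans (by simp [hN0])

variable {ι : Type*} [Fintype ι] {ν : ι → Measure ℝ} [∀ i, IsProbabilityMeasure (ν i)]

lemma map_prod_pi_absolutelyContinuous [Nonempty ι] (hν : ∀ i, ν i ≪ volume) :
    (Measure.pi ν).map (fun x => ∏ i, x i) ≪ volume := by
  classical
  obtain ⟨i₀⟩ := ‹Nonempty ι›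
  set Q : (ι → ℝ) → ℝ := fun x => ∏ i ∈ Finset.univ.erase i₀, x i
  have hmeas : Measurable Q := by fun_prop
  have hind : IndepFun Q (fun x => x i₀) (Measure.pi ν) := by
    have hcoord := (iIndepFun_pi (μ := ν) (X := fun _ x => x) fun _ => aemeasurable_id)
    simpa only [Finset.prod_fn] using
      hcoord.indepFun_finsetProd_of_notMem measurable_pi_apply (Finset.notMem_erase i₀ _)
  have hne : ∀ᵐ x ∂Measure.pi ν, ∀ i, x i ≠ 0 := ae_all_iff.mpr fun i =>
    (Measure.quasiMeasurePreserving_eval ν i).ae ((hν i).ae_le (Measure.ae_ne volume 0))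
  have hsplit : (fun x : ι → ℝ => ∏ i, x i) =
      (fun z : ℝ × ℝ => z.1 * z.2) ∘ fun x => (Q x, x i₀) :=
    funext fun x => (Finset.prod_erase_mul _ _ (Finset.mem_univ i₀)).symm
  rw [hsplit, ← Measure.map_map (by fun_prop) (by fun_prop),
    (indepFun_iff_map_prod_eq_prod_map_map hmeas.aemeasurable
      (measurable_pi_apply i₀).aemeasurable).mp hind, (measurePreserving_eval ν i₀).map_eq]
  refine map_mul_prod_absolutelyContinuous ?_ (hν i₀)
  rw [Measure.map_apply hmeas (measurableSet_singleton 0)]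
  refine measure_mono_null (fun x hx => ?_) hne
  obtain ⟨i, -, hi⟩ := Finset.prod_eq_zero_iff.mp hx
  exact fun hx0 => hx0 i hi

end Densities

section Gamma

open Complex Filter Topology

lemma gammaPDFReal_mul_exp {a r t : ℝ} (hr : 0 < r) (ht : t < r) (x : ℝ) :
    gammaPDFReal a r x * Real.exp (t * x) = (1 - t / r) ^ (-a) * gammaPDFReal a (r - t) x := by
  have hrt : 0 < r - t := sub_pos.mpr ht
  have hexp : Real.exp (-(r * x)) * Real.exp (t * x) = Real.exp (-((r - t) * x)) := by
    rw [← Real.exp_add]; ring_nf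
  have hpow : (1 - t / r) ^ (-a) * (r - t) ^ a = r ^ a := by
    rw [one_sub_div hr.ne', Real.rpow_neg (by positivity), Real.div_rpow hrt.le hr.le]
    have := (Real.rpow_pos_of_pos hrt a).ne'
    field_simp
  simp only [gammaPDFReal]
  split_ifs
  · rw [mul_assoc, hexp, ← hpow]; ring
  · simp

lemma lintegral_exp_mul_gammaMeasure {a r t : ℝ} (ha : 0 < a) (hr : 0 < r) (ht : t < r) :
    ∫⁻ x, ENNReal.ofReal (Real.exp (t * x)) ∂gammaMeasure a r =
      ENNReal.ofReal ((1 - t / r) ^ (-a)) := by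
  have hrt : 0 < r - t := sub_pos.mpr ht
  have hc : 0 ≤ (1 - t / r) ^ (-a) := by rw [one_sub_div hr.ne']; positivity
  have hmeas : Measurable (gammaPDF a r) := (measurable_gammaPDFReal a r).ennreal_ofReal
  rw [gammaMeasure, lintegral_withDensity_eq_lintegral_mul _ hmeas (by fun_prop)]
  simp only [Pi.mul_apply, gammaPDF, ← ENNReal.ofReal_mul (gammaPDFReal_nonneg ha hr _),
    gammaPDFReal_mul_exp hr ht, ENNReal.ofReal_mul hc]
  rw [lintegral_const_mul _ (measurable_gammaPDFReal a (r - t)).ennreal_ofReal]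
  exact (congrArg _ (lintegral_gammaPDF_eq_one ha hrt)).trans (mul_one _)

lemma integrable_exp_mul_gammaMeasure {a r t : ℝ} (ha : 0 < a) (hr : 0 < r) (ht : t < r) :
    Integrable (fun x => Real.exp (t * x)) (gammaMeasure a r) := by
  refine ⟨by fun_prop, ?_⟩
  rw [hasFiniteIntegral_iff_ofReal (ae_of_all _ fun x => (Real.exp_pos _).le),
    lintegral_exp_mul_gammaMeasure ha hr ht]
  exact ENNReal.ofReal_lt_top

lemma mgf_gammaMeasure {a r t : ℝ} (ha : 0 < a) (hr : 0 < r) (ht : t < r) :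
    mgf id (gammaMeasure a r) t = (1 - t / r) ^ (-a) := by
  have : 0 < r - t := sub_pos.mpr ht
  rw [mgf, integral_eq_lintegral_of_nonneg_ae (ae_of_all _ fun x => (Real.exp_pos _).le)
    (by fun_prop)]
  simp only [id_eq, lintegral_exp_mul_gammaMeasure ha hr ht]
  exact ENNReal.toReal_ofReal (by rw [one_sub_div hr.ne']; positivity)

lemma complexMGF_gammaMeasure {a r : ℝ} (ha : 0 < a) (hr : 0 < r) {z : ℂ} (hz : z.re < r) :
    complexMGF id (gammaMeasure a r) z = (1 - z / r) ^ (-a : ℂ) := by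
  have hset : Set.Iio r ⊆ interior (integrableExpSet id (gammaMeasure a r)) :=
    interior_maximal (fun t ht => integrable_exp_mul_gammaMeasure ha hr ht) isOpen_Iio
  have hre (z : ℂ) : (1 - z / r).re = (r - z.re) / r := by
    rw [sub_re, one_re, div_ofReal_re, sub_div, div_self hr.ne']
  have hmgf : AnalyticOnNhd ℂ (complexMGF id (gammaMeasure a r)) {z | z.re < r} :=
    analyticOnNhd_complexMGF.mono fun z hz => hset hz
  have hcpow : AnalyticOnNhd ℂ (fun z : ℂ => (1 - z / r) ^ (-a : ℂ)) {z | z.re < r} :=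
    AnalyticOnNhd.cpow (fun z _ => by fun_prop) analyticOnNhd_const fun z hz =>
      Or.inl (hre z ▸ div_pos (sub_pos.mpr hz) hr)
  have hreal : ∀ᶠ t : ℝ in 𝓝[≠] 0,
      complexMGF id (gammaMeasure a r) t = (1 - (t : ℂ) / r) ^ (-a : ℂ) := by
    filter_upwards [mem_nhdsWithin_of_mem_nhds (Iio_mem_nhds hr)] with t (ht : t < r)
    have : 0 ≤ 1 - t / r := by rw [one_sub_div hr.ne']; exact div_nonneg (sub_pos.mpr ht).le hr.le
    rw [complexMGF_ofReal, mgf_gammaMeasure ha hr ht, ofReal_cpow this]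
    push_cast
    rfl
  have hofReal : Tendsto ofReal (𝓝[≠] 0) (𝓝[≠] ((0 : ℝ) : ℂ)) :=
    continuous_ofReal.continuousAt.continuousWithinAt.tendsto_nhdsWithin fun t ht => by
      simpa using ht
  -- Both sides are analytic on `re z < r` and agree at the real points, which accumulate at `0`.
  exact hmgf.eqOn_of_preconnected_of_frequently_eq hcpow
    (convex_halfSpace_re_lt r).isPreconnected (z₀ := ((0 : ℝ) : ℂ)) (by simpa using hr)
    (hofReal.frequently hreal.frequently) hz

lemma charFun_gammaMeasure {a r : ℝ} (ha : 0 < a) (hr : 0 < r) (t : ℝ) :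
    charFun (gammaMeasure a r) t = (1 - t / r * I) ^ (-a : ℂ) := by
  rw [← complexMGF_id_mul_I, complexMGF_gammaMeasure ha hr (by simpa using hr), mul_div_right_comm]

lemma charFun_gammaMeasure_one_add_natCast (n : ℕ) {r : ℝ} (hr : 0 < r) (t : ℝ) :
    charFun (gammaMeasure (1 + n) r) t = (1 - t / r * I)⁻¹ ^ (n + 1) := by
  rw [charFun_gammaMeasure (by positivity) hr, cpow_neg, inv_pow, add_comm,
    ← cpow_natCast _ (n + 1)]
  push_cast
  rfl

lemma isProbabilityMeasure_gammaMeasure_one_add_natCast (n : ℕ) {r : ℝ} (hr : 0 < r) :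
    IsProbabilityMeasure (gammaMeasure (1 + n) r) :=
  isProbabilityMeasure_gammaMeasure (by positivity) hr

end Gamma

section ComplexNormal

open Complex

instance : IsProbabilityMeasure complexNormal :=
  Measure.isProbabilityMeasure_map
    (measurableEquivRealProd.symm.measurable.aemeasurable :)

lemma complexNormal_eq_withDensity : complexNormal =
    volume.withDensity fun z => ENNReal.ofReal (Real.pi⁻¹ * Real.exp (-‖z‖ ^ 2)) := by
  have hpdf (x y : ℝ) : gaussianPDF 0 (1 / 2) x * gaussianPDF 0 (1 / 2) y =
      ENNReal.ofReal (Real.pi⁻¹ * Real.exp (-‖(⟨x, y⟩ : ℂ)‖ ^ 2)) := by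
    have hvar : 2 * Real.pi * ((1 / 2 : NNReal) : ℝ) = Real.pi := by push_cast; ring
    have hsqrt : (√Real.pi)⁻¹ * (√Real.pi)⁻¹ = Real.pi⁻¹ := by
      rw [← mul_inv, Real.mul_self_sqrt Real.pi_pos.le]
    have hexp : -(x - 0) ^ 2 / (2 * ((1 / 2 : NNReal) : ℝ)) +
        -(y - 0) ^ 2 / (2 * ((1 / 2 : NNReal) : ℝ)) = -(x * x + y * y) := by push_cast; ring
    rw [gaussianPDF, gaussianPDF, ← ENNReal.ofReal_mul (gaussianPDFReal_nonneg _ _ _)]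
    simp only [gaussianPDFReal, Complex.sq_norm, normSq_mk, hvar]
    rw [mul_mul_mul_comm, ← Real.exp_add, hsqrt, hexp]
  have hmap : Measure.map (fun z : ℝ × ℝ => (⟨z.1, z.2⟩ : ℂ)) volume = volume :=
    volume_preserving_equiv_real_prod.symm.map_eq
  rw [complexNormal, gaussianReal_of_var_ne_zero 0 (by norm_num),
    prod_withDensity (by fun_prop) (by fun_prop)]
  ext s hs
  have hmk : Measurable fun z : ℝ × ℝ => (⟨z.1, z.2⟩ : ℂ) :=
    measurableEquivRealProd.symm.measurable
  rw [Measure.map_apply hmk hs, withDensity_apply _ (hmk hs), withDensity_apply _ hs, ← hmap,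
    setLIntegral_map hs (by fun_prop) hmk]
  simp only [hpdf]
  rfl

lemma integral_cexp_mul_norm_add_sq_complexNormal {b : ℂ} (hb : b.re < 1) (m : ℂ) :
    ∫ u, cexp (b * ‖u + m‖ ^ 2) ∂complexNormal = (1 - b)⁻¹ * cexp (‖m‖ ^ 2 * (b / (1 - b))) := by
  have hb' : 0 < (1 - b).re := by simpa using hb
  have hb0 : 1 - b ≠ 0 := fun h => by simp [h] at hb'
  have hintegrand (u : ℂ) : (ENNReal.ofReal (Real.pi⁻¹ * Real.exp (-‖u‖ ^ 2))).toReal •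
      cexp (b * ‖u + m‖ ^ 2) =
      (Real.pi : ℂ)⁻¹ * cexp (b * ‖m‖ ^ 2) *
        cexp (-(1 - b) * ‖u‖ ^ 2 + 2 * b * inner ℝ m u) := by
    have hsq : (‖u + m‖ : ℂ) ^ 2 = ‖u‖ ^ 2 + 2 * inner ℝ m u + ‖m‖ ^ 2 := by
      rw [real_inner_comm]
      exact_mod_cast norm_add_sq_real u m
    rw [ENNReal.toReal_ofReal (by positivity), real_smul, hsq]
    push_cast
    rw [mul_assoc, mul_assoc, ← Complex.exp_add, ← Complex.exp_add]
    ring_nf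
  rw [complexNormal_eq_withDensity, integral_withDensity_eq_integral_toReal_smul
    (by fun_prop) (ae_of_all _ fun _ => ENNReal.ofReal_lt_top)]
  simp only [hintegrand]
  have hexp : b * ‖m‖ ^ 2 + (2 * b) ^ 2 * ‖m‖ ^ 2 / (4 * (1 - b)) = ‖m‖ ^ 2 * (b / (1 - b)) := by
    field_simp
    ring
  have hpi := ofReal_ne_zero.mpr Real.pi_ne_zero
  rw [integral_const_mul, GaussianFourier.integral_cexp_neg_mul_sq_norm_add hb',
    finrank_real_complex, Nat.cast_two, div_self two_ne_zero, cpow_one, ← hexp, Complex.exp_add]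
  field_simp

lemma map_mul_norm_add_sq_complexNormal {Ω : ℝ} (hΩ : 0 < Ω) (m : ℂ) :
    complexNormal.map (fun u => Ω * ‖u + m‖ ^ 2) =
      (poissonMeasure (‖m‖₊ ^ 2)).bind fun n => gammaMeasure (1 + n) Ω⁻¹ := by
  have hprob (n : ℕ) : IsProbabilityMeasure (gammaMeasure (1 + n) Ω⁻¹) :=
    isProbabilityMeasure_gammaMeasure_one_add_natCast n (inv_pos.mpr hΩ)
  have : IsProbabilityMeasure
      ((poissonMeasure (‖m‖₊ ^ 2)).bind fun n : ℕ => gammaMeasure (1 + n) Ω⁻¹) :=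
    isProbabilityMeasure_bind (measurable_of_countable _).aemeasurable (ae_of_all _ hprob)
  refine Measure.ext_of_charFun (funext fun t => ?_)
  set b : ℂ := t * Ω * I with hb
  have hleft : charFun (complexNormal.map fun u => Ω * ‖u + m‖ ^ 2) t =
      (1 - b)⁻¹ * cexp (‖m‖ ^ 2 * (b / (1 - b))) := by
    rw [charFun_apply_real, integral_map (by fun_prop) (by fun_prop),
      ← integral_cexp_mul_norm_add_sq_complexNormal (by simp [hb])]
    refine integral_congr_ae (ae_of_all _ fun u => ?_)
    simp only [hb]
    push_cast
    ring_nf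
  have hb0 : 1 - b ≠ 0 := fun h => by simpa [hb] using congrArg re h
  have hterm (n : ℕ) : (poissonMeasure (‖m‖₊ ^ 2)).real {n} *
      charFun (gammaMeasure (1 + n) Ω⁻¹) t =
      cexp (-‖m‖ ^ 2) * (1 - b)⁻¹ * ((‖m‖ ^ 2 * (1 - b)⁻¹) ^ n / n !) := by
    rw [poissonMeasure_real_singleton, charFun_gammaMeasure_one_add_natCast n (inv_pos.mpr hΩ)]
    push_cast
    rw [div_inv_eq_mul, ← hb]
    ring
  have hright := hasSum_charFun_bind (poissonMeasure (‖m‖₊ ^ 2))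
    (fun n : ℕ => gammaMeasure (1 + n) Ω⁻¹) t
  simp only [hterm] at hright
  have hexp := (NormedSpace.expSeries_div_hasSum_exp (‖m‖ ^ 2 * (1 - b)⁻¹)).mul_left
    (cexp (-‖m‖ ^ 2) * (1 - b)⁻¹)
  rw [hleft, hright.unique hexp, ← exp_eq_exp_ℂ, mul_comm (cexp _), mul_assoc, ← Complex.exp_add]
  congr 2
  field_simp
  ring

lemma map_norm_sq_complexNormal : complexNormal.map (fun u => ‖u‖ ^ 2) = expMeasure 1 := by
  have hpoisson : poissonMeasure 0 = Measure.dirac 0 := by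
    refine Measure.ext_of_singleton fun n => ?_
    cases n <;> simp [poissonMeasure_singleton]
  simpa [hpoisson, Measure.dirac_bind (measurable_of_countable _), expMeasure] using
    map_mul_norm_add_sq_complexNormal one_pos 0

lemma map_mul_norm_add_sq_pi_complexNormal {ι : Type*} [Fintype ι] {Ω : ι → ℝ}
    (hΩ : ∀ i, 0 < Ω i) (m : ι → ℂ) :
    (Measure.pi fun _ : ι => complexNormal).map (fun u i => Ω i * ‖u i + m i‖ ^ 2) =
      (Measure.pi fun i => poissonMeasure (‖m i‖₊ ^ 2)).bind fun l =>
        Measure.pi fun i => gammaMeasure (1 + l i) (Ω i)⁻¹ := by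
  have hprob (i : ι) (n : ℕ) : IsProbabilityMeasure (gammaMeasure (1 + n) (Ω i)⁻¹) :=
    isProbabilityMeasure_gammaMeasure_one_add_natCast n (inv_pos.mpr (hΩ i))
  have hmap (i : ι) : AEMeasurable (fun u : ℂ => Ω i * ‖u + m i‖ ^ 2) complexNormal := by
    fun_prop
  have (i : ι) := Measure.isProbabilityMeasure_map (hmap i)
  rw [Measure.pi_map_pi hmap]
  simp only [map_mul_norm_add_sq_complexNormal (hΩ _)]
  exact pi_bind _ fun _ => measurable_of_countable _

end ComplexNormal

section MixedPoisson

open scoped NNReal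

lemma measurable_poissonMeasure : Measurable poissonMeasure := by
  refine Measure.measurable_of_measurable_coe _ fun s hs => ?_
  simp only [poissonMeasure, Measure.sum_apply _ hs, Measure.smul_apply]
  fun_prop

variable {ι : Type*} [Fintype ι] (a : ι → ℝ≥0)

/-- The law of counts `(N i)` which, given an exponential variable `T` of rate `1`, are independent
Poisson with intensities `a i * T`. The coercion `Real.toNNReal` is harmless as `T ≥ 0` a.s. -/
noncomputable def expMixedPoisson : Measure (ι → ℕ) :=
  (expMeasure 1).bind fun t => Measure.pi fun i => poissonMeasure (a i * t.toNNReal)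

lemma measurable_pi_poissonMeasure :
    Measurable fun t : ℝ => Measure.pi fun i => poissonMeasure (a i * t.toNNReal) :=
  measurable_pi_measure fun _ => measurable_poissonMeasure.comp (by fun_prop)

instance : IsProbabilityMeasure (expMixedPoisson a) :=
  have := isProbabilityMeasure_expMeasure one_pos
  isProbabilityMeasure_bind (measurable_pi_poissonMeasure a).aemeasurable
    (ae_of_all _ inferInstance)

lemma prod_poissonMeasure_real_singleton (t : ℝ≥0) (l : ι → ℕ) :
    ∏ i, (poissonMeasure (a i * t)).real {l i} =
      Real.exp (-((∑ i, (a i : ℝ)) * t)) * t ^ (∑ i, l i) * ∏ i, (a i : ℝ) ^ l i / (l i)! := by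
  have hexp : Real.exp (-((∑ i, (a i : ℝ)) * t)) = ∏ i, Real.exp (-(a i * t)) := by
    rw [← Real.exp_sum, Finset.sum_neg_distrib, Finset.sum_mul]
  rw [hexp, ← Finset.prod_pow_eq_pow_sum, ← Finset.prod_mul_distrib, ← Finset.prod_mul_distrib]
  refine Finset.prod_congr rfl fun i _ => ?_
  rw [poissonMeasure_real_singleton]
  push_cast
  ring

lemma gammaPDFReal_one_one_mul_prod_poissonMeasure (l : ι → ℕ) (t : ℝ) :
    gammaPDFReal 1 1 t * ∏ i, (poissonMeasure (a i * t.toNNReal)).real {l i} =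
      (1 + ∑ i, (a i : ℝ))⁻¹ * (∑ i, l i)! * (∏ i, (a i * (1 + ∑ j, (a j : ℝ))⁻¹) ^ l i / (l i)!) *
        gammaPDFReal ((∑ i, l i : ℕ) + 1) (1 + ∑ i, (a i : ℝ)) t := by
  obtain ht | ht := lt_or_ge t 0
  · simp [gammaPDFReal, ht.not_ge]
  set A : ℝ := 1 + ∑ i, (a i : ℝ) with hA
  have hA0 : 0 < A := by positivity
  have hexp : Real.exp (-(A * t)) = Real.exp (-t) * Real.exp (-((∑ i, (a i : ℝ)) * t)) := by
    rw [← Real.exp_add, hA]; ring_nf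
  have hprod : ∏ i, ((a i : ℝ) * A⁻¹) ^ l i / (l i)! =
      (A ^ ∑ i, l i)⁻¹ * ∏ i, (a i : ℝ) ^ l i / (l i)! := by
    rw [← inv_pow, ← Finset.prod_pow_eq_pow_sum, ← Finset.prod_mul_distrib]
    exact Finset.prod_congr rfl fun i _ => by ring
  simp only [gammaPDFReal, ht, if_true, prod_poissonMeasure_real_singleton, Real.coe_toNNReal t ht,
    Real.Gamma_nat_eq_factorial, Real.Gamma_one, Real.rpow_add_one hA0.ne', Real.rpow_natCast,
    add_sub_cancel_right, sub_self, Real.rpow_zero, one_mul, Real.one_rpow, hprod, hexp]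
  have hfac : ((∑ i, l i)! : ℝ) ≠ 0 := by positivity
  field_simp

lemma expMixedPoisson_real_singleton (l : ι → ℕ) :
    (expMixedPoisson a).real {l} = (1 + ∑ i, (a i : ℝ))⁻¹ * (∑ i, l i)! *
      ∏ i, (a i * (1 + ∑ j, (a j : ℝ))⁻¹) ^ l i / (l i)! := by
  set C : ℝ := (1 + ∑ i, (a i : ℝ))⁻¹ * (∑ i, l i)! *
      ∏ i, (a i * (1 + ∑ j, (a j : ℝ))⁻¹) ^ l i / (l i)!
  have hC : 0 ≤ C := by positivity
  have hdens (b r : ℝ) : Measurable (gammaPDF b r) := (measurable_gammaPDFReal b r).ennreal_ofReal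
  have hcond (t : ℝ) :
      gammaPDF 1 1 t * Measure.pi (fun i => poissonMeasure (a i * t.toNNReal)) {l} =
        ENNReal.ofReal C * gammaPDF ((∑ i, l i : ℕ) + 1) (1 + ∑ i, (a i : ℝ)) t := by
    rw [← ofReal_measureReal (measure_ne_top _ _), Measure.real, Measure.pi_singleton,
      ENNReal.toReal_prod, gammaPDF, ← ENNReal.ofReal_mul (gammaPDFReal_nonneg one_pos one_pos t)]
    exact (congrArg _ (gammaPDFReal_one_one_mul_prod_poissonMeasure a l t)).trans
      (ENNReal.ofReal_mul hC)
  have hmeas : Measurable fun t : ℝ =>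
      Measure.pi (fun i => poissonMeasure (a i * t.toNNReal)) {l} :=
    (Measure.measurable_coe (measurableSet_singleton l)).comp (measurable_pi_poissonMeasure a)
  rw [Measure.real, expMixedPoisson, Measure.bind_apply (measurableSet_singleton l)
    (measurable_pi_poissonMeasure a).aemeasurable, expMeasure, gammaMeasure,
    lintegral_withDensity_eq_lintegral_mul _ (hdens 1 1) hmeas]
  simp only [Pi.mul_apply, hcond]
  rw [lintegral_const_mul _ (hdens _ _), lintegral_gammaPDF_eq_one (by positivity) (by positivity),
    mul_one, ENNReal.toReal_ofReal hC]

lemma map_mul_norm_add_mul_sq_complexNormal {Ω : ι → ℝ} (hΩ : ∀ i, 0 < Ω i) (c : ι → ℂ) :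
    (complexNormal.prod (Measure.pi fun _ : ι => complexNormal)).map
        (fun z i => Ω i * ‖z.2 i + c i * z.1‖ ^ 2) =
      (expMixedPoisson fun i => ‖c i‖₊ ^ 2).bind fun l =>
        Measure.pi fun i => gammaMeasure (1 + l i) (Ω i)⁻¹ := by
  have hgamma : Measurable fun l : ι → ℕ => Measure.pi fun i => gammaMeasure (1 + l i) (Ω i)⁻¹ :=
    measurable_of_countable _
  have hpoisson := measurable_pi_poissonMeasure fun i => ‖c i‖₊ ^ 2
  have hmix : Measurable fun t : ℝ =>
      (Measure.pi fun i => poissonMeasure (‖c i‖₊ ^ 2 * t.toNNReal)).bind fun l =>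
        Measure.pi fun i => gammaMeasure (1 + l i) (Ω i)⁻¹ :=
    (Measure.measurable_bind' hgamma).comp hpoisson
  have hnorm (i : ι) (z : ℂ) : ‖c i * z‖₊ ^ 2 = ‖c i‖₊ ^ 2 * (‖z‖ ^ 2).toNNReal := by
    rw [nnnorm_mul, mul_pow, Real.toNNReal_pow (norm_nonneg z), norm_toNNReal]
  rw [map_prod_eq_bind _ _ (by fun_prop), expMixedPoisson, ← map_norm_sq_complexNormal,
    Measure.bind_bind hpoisson.aemeasurable hgamma.aemeasurable, bind_map hmix (by fun_prop)]
  simp only [map_mul_norm_add_sq_pi_complexNormal hΩ, hnorm]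

end MixedPoisson

section Channel

variable {K : ℕ} {ρ δ : ℝ}

lemma lag_pos (hδ : 0 < δ) (k : Fin K) : 0 < lag δ k := by
  have : (0 : ℝ) ≤ (k : ℕ) := Nat.cast_nonneg _
  unfold lag
  linarith

lemma rpow_two_mul_lag (hρδ : 0 ≤ ρ ∨ ∃ n : ℕ, δ = n) (k : Fin K) :
    ρ ^ (2 * lag δ k) = (ρ ^ lag δ k) ^ 2 := by
  obtain h | ⟨n, rfl⟩ := hρδ
  · rw [mul_comm, Real.rpow_mul h, Real.rpow_two]
  · have hlag : lag (n : ℝ) k = (k + n : ℕ) := by unfold lag; push_cast; ring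
    rw [hlag, mul_comm, ← Nat.cast_two, ← Nat.cast_mul]
    simp only [Real.rpow_natCast, pow_mul]

lemma rpow_two_mul_lag_lt_one (hρ : |ρ| < 1) (hδ : 0 < δ) (hρδ : 0 ≤ ρ ∨ ∃ n : ℕ, δ = n)
    (k : Fin K) : ρ ^ (2 * lag δ k) < 1 := by
  rw [rpow_two_mul_lag hρδ, sq_lt_one_iff_abs_lt_one]
  exact (Real.abs_rpow_le_abs_rpow _ _).trans_lt
    (Real.rpow_lt_one (abs_nonneg _) hρ (lag_pos hδ k))

lemma ratio_nonneg (hρ : |ρ| < 1) (hδ : 0 < δ) (hρδ : 0 ≤ ρ ∨ ∃ n : ℕ, δ = n) (k : Fin K) :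
    0 ≤ ratio ρ δ k :=
  div_nonneg (rpow_two_mul_lag hρδ k ▸ sq_nonneg _)
    (sub_nonneg.mpr (rpow_two_mul_lag_lt_one hρ hδ hρδ k).le)

lemma one_add_sum_ratio_pos (hρ : |ρ| < 1) (hδ : 0 < δ) (hρδ : 0 ≤ ρ ∨ ∃ n : ℕ, δ = n) :
    0 < 1 + ∑ k : Fin K, ratio ρ δ k :=
  add_pos_of_pos_of_nonneg one_pos (Finset.sum_nonneg fun k _ => ratio_nonneg hρ hδ hρδ k)

lemma w_nonneg (hρ : |ρ| < 1) (hδ : 0 < δ) (hρδ : 0 ≤ ρ ∨ ∃ n : ℕ, δ = n) (k : Fin K) :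
    0 ≤ w ρ δ k :=
  mul_nonneg (ratio_nonneg hρ hδ hρδ k) (inv_nonneg.mpr (one_add_sum_ratio_pos hρ hδ hρδ).le)

lemma one_sub_sum_w (hρ : |ρ| < 1) (hδ : 0 < δ) (hρδ : 0 ≤ ρ ∨ ∃ n : ℕ, δ = n) :
    1 - ∑ k : Fin K, w ρ δ k = (1 + ∑ k : Fin K, ratio ρ δ k)⁻¹ := by
  have hne := (one_add_sum_ratio_pos (K := K) hρ hδ hρδ).ne'
  simp only [w]
  rw [← Finset.sum_mul]
  field_simp
  ring

lemma sum_w_lt_one (hρ : |ρ| < 1) (hδ : 0 < δ) (hρδ : 0 ≤ ρ ∨ ∃ n : ℕ, δ = n) :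
    ∑ k : Fin K, w ρ δ k < 1 :=
  sub_pos.mp (one_sub_sum_w (K := K) hρ hδ hρδ ▸ inv_pos.mpr (one_add_sum_ratio_pos hρ hδ hρδ))

lemma W_eq_negMultinomial (hρ : |ρ| < 1) (hδ : 0 < δ) (hρδ : 0 ≤ ρ ∨ ∃ n : ℕ, δ = n)
    (l : Fin K → ℕ) : W ρ δ l = negMultinomial 1 (w ρ δ) l := by
  have hGamma : Real.Gamma (1 + ∑ k, (l k : ℝ)) = (∑ k, l k)! := by
    rw [add_comm, ← Nat.cast_sum, Real.Gamma_nat_eq_factorial]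
  rw [W, negMultinomial, one_sub_sum_w hρ hδ hρδ, hGamma, Real.Gamma_one, Real.rpow_one, div_one,
    mul_comm (_⁻¹)]

lemma scale_pos (hρ : |ρ| < 1) (hδ : 0 < δ) (hρδ : 0 ≤ ρ ∨ ∃ n : ℕ, δ = n) {σ p : Fin K → ℝ}
    (hσ : ∀ k, 0 < σ k) (hp : ∀ k, 0 < p k) (k : Fin K) : 0 < scale ρ δ σ p k :=
  mul_pos (mul_pos (hp k) (pow_pos (hσ k) 2))
    (sub_pos.mpr (rpow_two_mul_lag_lt_one hρ hδ hρδ k))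

/-- The factor of the common variable `α_0` in `h_k`, relative to the factor of `α_k`. Its square
is the parameter `a_k`. -/
noncomputable def commonCoeff (ρ δ : ℝ) (k : Fin K) : ℝ :=
  ρ ^ lag δ k / √(1 - ρ ^ (2 * lag δ k))

lemma sq_commonCoeff (hρ : |ρ| < 1) (hδ : 0 < δ) (hρδ : 0 ≤ ρ ∨ ∃ n : ℕ, δ = n) (k : Fin K) :
    commonCoeff ρ δ k ^ 2 = ratio ρ δ k := by
  have hlt := rpow_two_mul_lag_lt_one hρ hδ hρδ k
  rw [commonCoeff, div_pow, Real.sq_sqrt (sub_nonneg.mpr hlt.le), ratio, rpow_two_mul_lag hρδ]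

lemma snr_eq {S : Type*} (hρ : |ρ| < 1) (hδ : 0 < δ) (hρδ : 0 ≤ ρ ∨ ∃ n : ℕ, δ = n)
    (σ p : Fin K → ℝ) (α : Fin (K + 1) → S → ℂ) (k : Fin K) (s : S) :
    snr ρ δ σ p α k s =
      scale ρ δ σ p k * ‖α k.succ s + (commonCoeff ρ δ k : ℂ) * α 0 s‖ ^ 2 := by
  have hpos := sub_pos.mpr (rpow_two_mul_lag_lt_one hρ hδ hρδ k)
  have hsqrt : (√(1 - ρ ^ (2 * lag δ k)) : ℂ) ≠ 0 :=
    Complex.ofReal_ne_zero.mpr (Real.sqrt_pos.mpr hpos).ne'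
  have hchannel : channel ρ δ σ α k s = ((σ k * √(1 - ρ ^ (2 * lag δ k)) : ℝ) : ℂ) *
      (α k.succ s + (commonCoeff ρ δ k : ℂ) * α 0 s) := by
    unfold channel commonCoeff
    push_cast
    field_simp
  rw [snr, hchannel, norm_mul, mul_pow, Complex.norm_real, Real.norm_eq_abs, sq_abs, mul_pow,
    Real.sq_sqrt hpos.le, scale]
  ring

/-- The law `NM(1, w)` of the mixing index `l`, encoded by the construction it arises from: given
`α_0`, the `l_k` are independent Poisson with intensities `a_k |α_0|²`. -/
noncomputable def mixingLaw (ρ δ : ℝ) : Measure (Fin K → ℕ) :=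
  expMixedPoisson fun k => ‖(commonCoeff ρ δ k : ℂ)‖₊ ^ 2

instance : IsProbabilityMeasure (mixingLaw (K := K) ρ δ) :=
  inferInstanceAs (IsProbabilityMeasure (expMixedPoisson _))

lemma mixingLaw_real_singleton (hρ : |ρ| < 1) (hδ : 0 < δ) (hρδ : 0 ≤ ρ ∨ ∃ n : ℕ, δ = n)
    (l : Fin K → ℕ) : (mixingLaw ρ δ).real {l} = W ρ δ l := by
  simp only [mixingLaw, expMixedPoisson_real_singleton, NNReal.coe_pow, coe_nnnorm,
    Complex.norm_real, Real.norm_eq_abs, sq_abs, sq_commonCoeff hρ hδ hρδ, W, w]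

lemma W_nonneg (hρ : |ρ| < 1) (hδ : 0 < δ) (hρδ : 0 ≤ ρ ∨ ∃ n : ℕ, δ = n) (l : Fin K → ℕ) :
    0 ≤ W ρ δ l :=
  mixingLaw_real_singleton hρ hδ hρδ l ▸ measureReal_nonneg

lemma hasSum_W (hρ : |ρ| < 1) (hδ : 0 < δ) (hρδ : 0 ≤ ρ ∨ ∃ n : ℕ, δ = n) :
    HasSum (fun l : Fin K → ℕ => W ρ δ l) 1 := by
  simpa [← mixingLaw_real_singleton hρ hδ hρδ, Measure.real] using
    hasSum_integral_measure (μ := fun l : Fin K → ℕ => mixingLaw ρ δ {l} • Measure.dirac l)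
      (f := fun _ => (1 : ℝ)) (by simp)

lemma isProbabilityMeasure_gammaLaw {Ω : Fin K → ℝ} (hΩ : ∀ k, 0 < Ω k) (l : Fin K → ℕ) :
    IsProbabilityMeasure (gammaLaw Ω l) :=
  have (k : Fin K) : IsProbabilityMeasure (gammaMeasure (1 + l k) (Ω k)⁻¹) :=
    isProbabilityMeasure_gammaMeasure_one_add_natCast (l k) (inv_pos.mpr (hΩ k))
  inferInstanceAs (IsProbabilityMeasure (Measure.pi _))

lemma measurable_shiftedProd : Measurable (shiftedProd (K := K)) := by
  unfold shiftedProd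
  fun_prop

lemma map_shiftedProd_gammaLaw_absolutelyContinuous (hK : 1 ≤ K) {Ω : Fin K → ℝ}
    (hΩ : ∀ k, 0 < Ω k) (l : Fin K → ℕ) : (gammaLaw Ω l).map shiftedProd ≪ volume := by
  have : Nonempty (Fin K) := ⟨⟨0, hK⟩⟩
  have hprob (k : Fin K) : IsProbabilityMeasure (gammaMeasure (1 + l k) (Ω k)⁻¹) :=
    isProbabilityMeasure_gammaMeasure_one_add_natCast (l k) (inv_pos.mpr (hΩ k))
  have hshift (k : Fin K) : AEMeasurable (fun r : ℝ => 1 + r) (gammaMeasure (1 + l k) (Ω k)⁻¹) := by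
    fun_prop
  have hprob_map (k : Fin K) := Measure.isProbabilityMeasure_map (hshift k)
  have hac (k : Fin K) : (gammaMeasure (1 + l k) (Ω k)⁻¹).map (fun r => 1 + r) ≪ volume := by
    have hmap := (withDensity_absolutelyContinuous volume
      (gammaPDF (1 + l k) (Ω k)⁻¹)).map (measurable_const_add (1 : ℝ))
    rwa [map_add_left_eq_self volume] at hmap
  have hsplit : (gammaLaw Ω l).map shiftedProd =
      ((gammaLaw Ω l).map fun r k => 1 + r k).map fun x => ∏ k, x k := by
    rw [Measure.map_map (by fun_prop) (by fun_prop)]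
    rfl
  rw [hsplit, gammaLaw, Measure.pi_map_pi hshift]
  exact map_prod_pi_absolutelyContinuous hac

variable {S : Type*} [MeasurableSpace S] {μ : Measure S} {α : Fin (K + 1) → S → ℂ}

lemma aemeasurable_snr (hα : ∀ i, AEMeasurable (α i) μ) (σ p : Fin K → ℝ) :
    AEMeasurable (fun s k => snr ρ δ σ p α k s) μ := by
  unfold snr channel
  fun_prop

lemma map_snr_eq_bind (hρ : |ρ| < 1) (hδ : 0 < δ) (hρδ : 0 ≤ ρ ∨ ∃ n : ℕ, δ = n)
    {σ p : Fin K → ℝ} (hσ : ∀ k, 0 < σ k) (hp : ∀ k, 0 < p k)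
    (hα : ∀ i, HasLaw (α i) complexNormal μ) (hind : iIndepFun α μ) :
    μ.map (fun s k => snr ρ δ σ p α k s) =
      (mixingLaw ρ δ).bind fun l => gammaLaw (scale ρ δ σ p) l := by
  have hlaw : HasLaw (fun s => (α 0 s, fun k : Fin K => α k.succ s))
      (complexNormal.prod (Measure.pi fun _ : Fin K => complexNormal)) μ :=
    (measurePreserving_piFinSuccAbove (fun _ : Fin (K + 1) => complexNormal) 0).comp_hasLaw
      (hind.hasLaw_pi hα)
  simp only [mixingLaw, gammaLaw, snr_eq hρ hδ hρδ]
  rw [← map_mul_norm_add_mul_sq_complexNormal (scale_pos hρ hδ hρδ hσ hp), ← hlaw.map_eq,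
    AEMeasurable.map_map_of_aemeasurable (by fun_prop) hlaw.aemeasurable]
  rfl

lemma map_snrProd_eq_bind (hρ : |ρ| < 1) (hδ : 0 < δ) (hρδ : 0 ≤ ρ ∨ ∃ n : ℕ, δ = n)
    {σ p : Fin K → ℝ} (hσ : ∀ k, 0 < σ k) (hp : ∀ k, 0 < p k)
    (hα : ∀ i, HasLaw (α i) complexNormal μ) (hind : iIndepFun α μ) :
    μ.map (snrProd ρ δ σ p α) =
      (mixingLaw ρ δ).bind fun l => (gammaLaw (scale ρ δ σ p) l).map shiftedProd := by
  rw [← map_bind (measurable_of_countable _) measurable_shiftedProd,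
    ← map_snr_eq_bind hρ hδ hρδ hσ hp hα hind, AEMeasurable.map_map_of_aemeasurable
      measurable_shiftedProd.aemeasurable (aemeasurable_snr (fun i => (hα i).aemeasurable) σ p)]
  rfl

end Channel

end CorrRayleigh

theorem theorem1 {S : Type*} [MeasurableSpace S] (μ : Measure S) [IsProbabilityMeasure μ]
    (K : ℕ) (hK : 1 ≤ K) (ρ δ : ℝ) (hρ : |ρ| < 1) (hδ : 0 < δ)
    (hρδ : 0 ≤ ρ ∨ ∃ n : ℕ, δ = n)
    (σ p : Fin K → ℝ) (hσ : ∀ k, 0 < σ k) (hp : ∀ k, 0 < p k)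
    (α : Fin (K + 1) → S → ℂ)
    (hα : ∀ i, HasLaw (α i) CorrRayleigh.complexNormal μ) (hind : iIndepFun α μ) :
    -- `G` and every `A_l` have a probability density function
    HasPDF (CorrRayleigh.snrProd ρ δ σ p α) μ volume ∧
    (∀ l : Fin K → ℕ, HasPDF (CorrRayleigh.shiftedProd (K := K))
      (CorrRayleigh.gammaLaw (CorrRayleigh.scale ρ δ σ p) l) volume) ∧
    -- the density of `G` is the mixture of those of the `A_l` with weights `W_l`
    (∀ᵐ x : ℝ, HasSum
      (fun l : Fin K → ℕ =>
        CorrRayleigh.W ρ δ l * CorrRayleigh.pdfA (CorrRayleigh.scale ρ δ σ p) l x)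
      (pdf (CorrRayleigh.snrProd ρ δ σ p α) μ volume x).toReal) ∧
    -- the weights are the probability mass function of `NM(1, w)`
    (∀ k : Fin K, 0 ≤ CorrRayleigh.w ρ δ k) ∧
    (∑ k : Fin K, CorrRayleigh.w ρ δ k) < 1 ∧
    (∀ l : Fin K → ℕ,
      CorrRayleigh.W ρ δ l = CorrRayleigh.negMultinomial 1 (CorrRayleigh.w ρ δ) l) ∧
    (∀ l : Fin K → ℕ, 0 ≤ CorrRayleigh.W ρ δ l) ∧
    HasSum (fun l : Fin K → ℕ => CorrRayleigh.W ρ δ l) 1 := by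
  open CorrRayleigh in
  have hΩ := scale_pos hρ hδ hρδ hσ hp
  have hmeas := measurable_shiftedProd (K := K)
  have hprob (l : Fin K → ℕ) := isProbabilityMeasure_gammaLaw hΩ l
  have hprob_map (l : Fin K → ℕ) := Measure.isProbabilityMeasure_map (hmeas.aemeasurable
    (μ := gammaLaw (scale ρ δ σ p) l))
  have hac := map_shiftedProd_gammaLaw_absolutelyContinuous hK hΩ
  have hG := map_snrProd_eq_bind hρ hδ hρδ hσ hp hα hind
  have hGmeas := hmeas.comp_aemeasurable
    (aemeasurable_snr (ρ := ρ) (δ := δ) (fun i => (hα i).aemeasurable) σ p)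
  have hGac : μ.map (snrProd ρ δ σ p α) ≪ volume :=
    hG ▸ bind_absolutelyContinuous (measurable_of_countable _) hac
  have hdens := ae_hasSum_rnDeriv_bind (mixingLaw ρ δ) hac
  simp only [mixingLaw_real_singleton hρ hδ hρδ, ← hG] at hdens
  exact ⟨⟨hGmeas, inferInstance, hGac⟩, fun l => ⟨hmeas.aemeasurable, inferInstance, hac l⟩, hdens,
    w_nonneg hρ hδ hρδ, sum_w_lt_one hρ hδ hρδ,
    W_eq_negMultinomial hρ hδ hρδ, W_nonneg hρ hδ hρδ,
    hasSum_W hρ hδ hρδ⟩
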